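/- Let $n \in \mathbb{N}$ and let $P \in \mathbb{R}^{n\times n}$ be a projection ($P^2 = P$, not necessarily orthogonal) with $P \neq 0$. For $A \in \mathbb{R}^{n\times n}$, $T > 0$ and $u \in C([0,T],\mathbb{R}^n)$ let $x$ be the unique solution on $[0,T]$ of \[ \dot x(t) = A x(t) + P u(t), \qquad x(0) = 0, \] and put $W_T(u) := \int_0^T \langle x(t), P u(t)\rangle \, dt$, where $\langle\cdot,\cdot\rangle$ is the Euclidean inner product. The system $\dot x = Ax + Pu$ is called locally active if $W_T(u) < 0$ for some $T > 0$ and some $u \in C([0,T],\mathbb{R}^n)$. Then there exists an open and dense set $\mathcal{M} \subseteq \mathbb{R}^{n\times n}$ (depending only on $P$) such that for every $A \in \mathcal{M}$ that has a complex eigenvalue with positive real part, the system $\dot x = Ax + Pu$ is locally active; more precisely, there exist $T \geq 2$ and $u \in C([0,T],\mathbb{R}^n)$ with $W_T(u) < 0$. -/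

import Mathlib

/-- `x` solves the initial value problem `x' = A x + P u`, `x(0) = 0`, on the interval `[0, T]`
(with one-sided derivatives at the end points). For continuous `u` there is exactly one such `x`
on `[0, T]`. -/
structure IsSolution {n : ℕ} (A P : Matrix (Fin n) (Fin n) ℝ) (T : ℝ)
    (u x : ℝ → Fin n → ℝ) : Prop where
  initial : x 0 = 0
  hasDeriv : ∀ t ∈ Set.Icc (0 : ℝ) T,
    HasDerivWithinAt x (A.mulVec (x t) + P.mulVec (u t)) (Set.Icc (0 : ℝ) T) t

/-- The integral `∫₀ᵀ ⟨x(t), P u(t)⟩ dt`, with the standard inner product of `ℝⁿ`. It is `W_T(u)`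
when `x` is the solution that belongs to the input `u`. -/
noncomputable def portWork {n : ℕ} (P : Matrix (Fin n) (Fin n) ℝ) (T : ℝ)
    (u x : ℝ → Fin n → ℝ) : ℝ :=
  ∫ t in (0 : ℝ)..T, dotProduct (x t) (P.mulVec (u t))

/-- There is a continuous input `u` on `[0, T]` with `W_T(u) < 0`. -/
def HasNegativeWork {n : ℕ} (A P : Matrix (Fin n) (Fin n) ℝ) (T : ℝ) : Prop :=
  ∃ u : ℝ → Fin n → ℝ, ContinuousOn u (Set.Icc (0 : ℝ) T) ∧
    ∃ x : ℝ → Fin n → ℝ, IsSolution A P T u x ∧ portWork P T u x < 0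

/-- The system `x' = A x + P u` is locally active. -/
def IsLocallyActive {n : ℕ} (A P : Matrix (Fin n) (Fin n) ℝ) : Prop :=
  ∃ T : ℝ, 0 < T ∧ HasNegativeWork A P T

/-- The real matrix `A` has a (complex) eigenvalue with positive real part. -/
def HasUnstableEigenvalue {n : ℕ} (A : Matrix (Fin n) (Fin n) ℝ) : Prop :=
  ∃ μ : ℂ, Module.End.HasEigenvalue (Matrix.toLin' (A.map Complex.ofReal)) μ ∧ 0 < μ.re

/-! Fix b ≠ 0 with P b = b and use only inputs u = f b with f scalar, so that W_T = ∫ l(x) f with l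
= ⟨b, ·⟩. For generic A, b is cyclic for A and for Aᵀ: a left eigenvector of an unstable eigenvalue
then does not annihilate b, and l observes every state. A pulse on [0, 1], of fixed work K, excites
the unstable mode, and the free motion grows without bound. When it has reached a large state z, the
input -ε g is applied for unit time, where g is a ramp times the output of the free motion. Its work
is at most -ε c‖z‖² + ε² C‖z‖², with c from `exists_observability_bound`. As c and C do not depend
on z, one small ε serves for all z, and the gain outweighs K (`exists_integral_forcedResponse_neg`).
Genericity holds because the Krylov determinant is a polynomial in A that is not identically zero
(`dense_det_krylovMatrix_ne_zero`). -/

open NormedSpace MeasureTheory intervalIntegral Filter Topology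

/-! ### Linear flows, variation of constants and observability -/

section Flow

variable {E : Type*} [NormedAddCommGroup E] [NormedSpace ℝ E]

/-- The flow `t ↦ exp (t A)` of the linear differential equation `x' = A x`. -/
noncomputable def linearFlow (A : E →L[ℝ] E) (t : ℝ) : E →L[ℝ] E := exp (t • A)

theorem linearFlow_zero (A : E →L[ℝ] E) : linearFlow A 0 = 1 := by
  simp [linearFlow]

/-- The variation of constants formula for the solution of `x' = A x + f b`, `x 0 = 0`. -/
noncomputable def forcedResponse (A : E →L[ℝ] E) (b : E) (f : ℝ → ℝ) (t : ℝ) : E :=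
  linearFlow A t (∫ s in (0 : ℝ)..t, f s • linearFlow A (-s) b)

theorem forcedResponse_zero (A : E →L[ℝ] E) (b : E) (f : ℝ → ℝ) :
    forcedResponse A b f 0 = 0 := by
  simp [forcedResponse]

variable [CompleteSpace E]

theorem linearFlow_add (A : E →L[ℝ] E) (s t : ℝ) :
    linearFlow A (s + t) = linearFlow A s * linearFlow A t := by
  let _ : NormedAlgebra ℚ (E →L[ℝ] E) := NormedAlgebra.restrictScalars ℚ ℝ _
  rw [linearFlow, add_smul]
  exact exp_add_of_commute (((Commute.refl A).smul_left s).smul_right t)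

theorem linearFlow_add_apply (A : E →L[ℝ] E) (s t : ℝ) (x : E) :
    linearFlow A (s + t) x = linearFlow A s (linearFlow A t x) := by
  rw [linearFlow_add]; rfl

theorem hasDerivAt_linearFlow (A : E →L[ℝ] E) (t : ℝ) :
    HasDerivAt (linearFlow A) (A * linearFlow A t) t :=
  hasDerivAt_exp_smul_const' A t

theorem continuous_linearFlow (A : E →L[ℝ] E) : Continuous (linearFlow A) :=
  continuous_iff_continuousAt.2 fun t => (hasDerivAt_linearFlow A t).continuousAt

@[fun_prop]
theorem Continuous.linearFlow_apply {X : Type*} [TopologicalSpace X] (A : E →L[ℝ] E) {g : X → ℝ}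
    {x : X → E} (hg : Continuous g) (hx : Continuous x) :
    Continuous fun s => linearFlow A (g s) (x s) :=
  ((continuous_linearFlow A).comp hg).clm_apply hx

theorem hasDerivAt_forcedResponse (A : E →L[ℝ] E) (b : E) {f : ℝ → ℝ} (hf : Continuous f)
    (t : ℝ) :
    HasDerivAt (forcedResponse A b f) (A (forcedResponse A b f t) + f t • b) t := by
  have hc : Continuous fun s => f s • linearFlow A (-s) b := by fun_prop
  have h := (hasDerivAt_linearFlow A t).clm_apply
    (integral_hasDerivAt_right (hc.intervalIntegrable 0 t)
      (hc.stronglyMeasurableAtFilter _ _) hc.continuousAt)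
  refine h.congr_deriv ?_
  rw [map_smul, ← linearFlow_add_apply, add_neg_cancel, linearFlow_zero]
  rfl

theorem continuous_forcedResponse (A : E →L[ℝ] E) (b : E) {f : ℝ → ℝ} (hf : Continuous f) :
    Continuous (forcedResponse A b f) :=
  continuous_iff_continuousAt.2 fun t => (hasDerivAt_forcedResponse A b hf t).continuousAt

theorem linearFlow_left_eigenvector {A : E →L[ℝ] E} {w : E →L[ℝ] ℂ} {μ : ℂ}
    (hw : ∀ x, w (A x) = μ * w x) (t : ℝ) (x : E) :
    w (linearFlow A t x) = Complex.exp (μ * t) * w x := by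
  have hd : ∀ s : ℝ, HasDerivAt (fun s : ℝ => Complex.exp (-(μ * s)) * w (linearFlow A s x)) 0 s := by
    intro s
    have h1 : HasDerivAt (fun s : ℝ => Complex.exp (-(μ * s))) (Complex.exp (-(μ * s)) * -(μ * 1)) s :=
      (((Complex.ofRealCLM.hasDerivAt (x := s)).const_mul μ).neg).cexp
    have h2 : HasDerivAt (fun s : ℝ => w (linearFlow A s x)) (w (A (linearFlow A s x))) s := by
      have := (hasDerivAt_linearFlow A s).clm_apply (hasDerivAt_const s x)
      simp only [map_zero, add_zero] at this
      exact w.hasFDerivAt.comp_hasDerivAt s this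
    refine (h1.mul h2).congr_deriv ?_
    rw [hw]; ring
  have h := is_const_of_deriv_eq_zero (fun s => (hd s).differentiableAt) (fun s => (hd s).deriv) t 0
  simp only [Complex.ofReal_zero, mul_zero, neg_zero, Complex.exp_zero, one_mul,
    linearFlow_zero] at h
  rw [Complex.exp_neg] at h
  field_simp [Complex.exp_ne_zero] at h
  simpa using h

/-- Observability: the Gramian `∫₀¹ s ℓ(exp(sA) z)² ds` is coercive if no nonzero vector is
annihilated by all `ℓ ∘ A ^ k`. -/
theorem exists_observability_bound [FiniteDimensional ℝ E] (A : E →L[ℝ] E) (l : E →L[ℝ] ℝ)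
    (hobs : ∀ z, (∀ k : ℕ, l ((A ^ k) z) = 0) → z = 0) :
    ∃ c > 0, ∀ z, c * ‖z‖ ^ 2 ≤ ∫ s in (0 : ℝ)..1, s * l (linearFlow A s z) ^ 2 := by
  set q : E → ℝ := fun z => ∫ s in (0 : ℝ)..1, s * l (linearFlow A s z) ^ 2 with hq
  have hqc : Continuous q := by
    refine continuous_parametric_intervalIntegral_of_continuous' ?_ 0 1
    fun_prop
  have hpos : ∀ z, z ≠ 0 → 0 < q z := by
    intro z hz
    by_contra hle
    refine hz ?_
    have hzero : ∀ s ∈ Set.Ioo (0 : ℝ) 1, l (linearFlow A s z) = 0 := by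
      intro s hs
      by_contra hne
      refine hle (integral_pos one_pos ?_ ?_ ⟨s, ⟨hs.1.le, hs.2.le⟩, ?_⟩)
      · exact Continuous.continuousOn (by fun_prop)
      · intro r hr
        have := hr.1
        positivity
      · have := hs.1
        positivity
    -- Differentiating the vanishing output k times on the open interval brings in `A ^ k`.
    have hk : ∀ k : ℕ, ∀ s ∈ Set.Ioo (0 : ℝ) 1, l ((A ^ k) (linearFlow A s z)) = 0 := by
      intro k
      induction k with
      | zero => simpa using hzero
      | succ k ih =>
        intro s hs
        have hd : HasDerivAt (fun s : ℝ => l ((A ^ k) (linearFlow A s z)))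
            (l ((A ^ k) (A (linearFlow A s z)))) s := by
          have := (hasDerivAt_linearFlow A s).clm_apply (hasDerivAt_const s z)
          simp only [map_zero, add_zero] at this
          exact (l.comp (A ^ k)).hasFDerivAt.comp_hasDerivAt s this
        have h0 : (fun s : ℝ => l ((A ^ k) (linearFlow A s z))) =ᶠ[𝓝 s] fun _ => 0 := by
          filter_upwards [isOpen_Ioo.mem_nhds hs] with r hr using ih r hr
        have := hd.unique ((hasDerivAt_const s (0 : ℝ)).congr_of_eventuallyEq h0)
        rwa [pow_succ]
    have h2 := hobs _ fun k => hk k (1 / 2) (by norm_num)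
    have h3 := linearFlow_add_apply A (-(1 / 2)) (1 / 2) z
    rw [h2, map_zero, neg_add_cancel, linearFlow_zero] at h3
    exact h3
  have hhom : ∀ (r : ℝ) z, q (r • z) = r ^ 2 * q z := by
    intro r z
    simp only [hq, map_smul, smul_eq_mul, mul_pow]
    rw [← intervalIntegral.integral_const_mul]
    congr 1; ext s; ring
  rcases subsingleton_or_nontrivial E with hE | hE
  · refine ⟨1, one_pos, fun z => ?_⟩
    simp [Subsingleton.elim z 0]
  -- `q` is homogeneous of degree 2, so its minimum on the unit sphere serves as c.
  · obtain ⟨z₀, hz₀, hmin⟩ := (isCompact_sphere (0 : E) 1).exists_isMinOn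
      (NormedSpace.sphere_nonempty.2 zero_le_one) hqc.continuousOn
    have hz₀' : z₀ ≠ 0 := by
      rintro rfl; simp at hz₀
    refine ⟨q z₀, hpos z₀ hz₀', fun z => ?_⟩
    rcases eq_or_ne z 0 with rfl | hz
    · simp
    have hn : ‖z‖ ≠ 0 := norm_ne_zero_iff.2 hz
    have h1 : q z₀ ≤ q (‖z‖⁻¹ • z) := hmin (by simp [norm_smul, hn])
    have h2 := hhom ‖z‖ (‖z‖⁻¹ • z)
    rw [smul_inv_smul₀ hn] at h2
    change _ ≤ q z
    rw [h2, mul_comm]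
    gcongr

end Flow

/-! ### Work of a pulse followed by a delayed extraction -/

section Work

variable {E : Type*} [NormedAddCommGroup E] [NormedSpace ℝ E]

theorem forcedResponse_of_eq_zero_before (A : E →L[ℝ] E) (b : E) {f : ℝ → ℝ} {a : ℝ}
    (h0 : ∀ s ≤ a, f s = 0) {t : ℝ} (ht0 : 0 ≤ t) (ht : t ≤ a) : forcedResponse A b f t = 0 := by
  have h : ∫ s in (0 : ℝ)..t, f s • linearFlow A (-s) b = 0 := by
    refine integral_zero_ae (ae_of_all _ fun s hs => ?_)
    rw [Set.uIoc_of_le ht0] at hs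
    simp [h0 s (hs.2.trans ht)]
  rw [forcedResponse, h, map_zero]

variable [CompleteSpace E]

theorem continuous_forcing_integrand (A : E →L[ℝ] E) (b : E) {f : ℝ → ℝ} (hf : Continuous f) :
    Continuous fun s => f s • linearFlow A (-s) b := by fun_prop

theorem forcedResponse_sub_const_mul (A : E →L[ℝ] E) (b : E) {f g : ℝ → ℝ} (hf : Continuous f)
    (hg : Continuous g) (ε t : ℝ) :
    forcedResponse A b (fun s => f s - ε * g s) t =
      forcedResponse A b f t - ε • forcedResponse A b g t := by
  simp only [forcedResponse, sub_smul, mul_smul]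
  rw [intervalIntegral.integral_sub, intervalIntegral.integral_smul, map_sub, map_smul]
  · exact (continuous_forcing_integrand A b hf).intervalIntegrable _ _
  · exact ((continuous_forcing_integrand A b hg).const_smul ε).intervalIntegrable _ _

theorem forcedResponse_of_eq_zero_after (A : E →L[ℝ] E) (b : E) {f : ℝ → ℝ} (hf : Continuous f)
    {a : ℝ} (h0 : ∀ s, a ≤ s → f s = 0) {t : ℝ} (ht : a ≤ t) :
    forcedResponse A b f t = linearFlow A t (∫ s in (0 : ℝ)..a, f s • linearFlow A (-s) b) := by
  have hc := continuous_forcing_integrand A b hf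
  have h : ∫ s in a..t, f s • linearFlow A (-s) b = 0 := by
    refine integral_zero_ae (ae_of_all _ fun s hs => ?_)
    rw [Set.uIoc_of_le ht] at hs
    simp [h0 s hs.1.le]
  rw [forcedResponse, ← integral_add_adjacent_intervals (hc.intervalIntegrable 0 a)
    (hc.intervalIntegrable a t), h, add_zero]

theorem norm_forcedResponse_le (A : E →L[ℝ] E) (b : E) {f : ℝ → ℝ} (hf : Continuous f)
    {m K θ s : ℝ} (hm : ∀ r ∈ Set.Icc (0 : ℝ) 1, ‖linearFlow A r‖ ≤ m) (hθ : 0 ≤ θ)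
    (hs : s ∈ Set.Icc (0 : ℝ) 1) (h0 : ∀ r ≤ θ, f r = 0)
    (hK : ∀ r ∈ Set.Icc θ (θ + 1), |f r| ≤ K) :
    ‖forcedResponse A b f (θ + s)‖ ≤ K * (m * ‖b‖) := by
  have hc := continuous_forcing_integrand A b hf
  have h : ∫ r in (0 : ℝ)..θ, f r • linearFlow A (-r) b = 0 := by
    refine integral_zero_ae (ae_of_all _ fun s hs => ?_)
    rw [Set.uIoc_of_le hθ] at hs
    simp [h0 s hs.2]
  rw [forcedResponse, ← integral_add_adjacent_intervals (hc.intervalIntegrable 0 θ)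
    (hc.intervalIntegrable θ (θ + s)), h, zero_add,
    ← ContinuousLinearMap.intervalIntegral_comp_comm _ (hc.intervalIntegrable θ (θ + s))]
  have hK0 : 0 ≤ K := (abs_nonneg _).trans (hK θ ⟨le_rfl, by linarith⟩)
  have hm0 : 0 ≤ m := (norm_nonneg _).trans (hm 0 (by simp))
  refine (intervalIntegral.norm_integral_le_of_norm_le_const (C := K * (m * ‖b‖)) fun r hr => ?_).trans ?_
  · rw [Set.uIoc_of_le (by linarith [hs.1])] at hr
    rw [map_smul, ← linearFlow_add_apply, norm_smul]
    gcongr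
    · exact hK r ⟨hr.1.le, by linarith [hr.2, hs.2]⟩
    · refine (ContinuousLinearMap.le_opNorm _ _).trans ?_
      gcongr
      exact hm _ ⟨by linarith [hr.2], by linarith [hr.1, hs.2]⟩
  · rw [add_sub_cancel_left, abs_of_nonneg hs.1]
    exact mul_le_of_le_one_right (by positivity) hs.2

/-- A scalar pulse on `[0, 1]` that excites an unstable mode. -/
theorem exists_pulse {A : E →L[ℝ] E} {b : E} {w : E →L[ℝ] ℂ} {μ : ℂ}
    (hw : ∀ x, w (A x) = μ * w x) (hwb : w b ≠ 0) :
    ∃ f : ℝ → ℝ, Continuous f ∧ (∀ s, 1 ≤ s → f s = 0) ∧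
      w (∫ s in (0 : ℝ)..1, f s • linearFlow A (-s) b) ≠ 0 := by
  set e : ℝ → ℂ := fun s => Complex.exp (μ * (-s : ℝ)) with he
  have hec : Continuous e := by fun_prop
  -- Weighting by Re e makes the real part of the excitation factor the integral of (1 - s)(Re e)²,
  -- which is positive; the ramp switches the pulse off continuously at 1.
  have hf : Continuous fun s : ℝ => max 0 (1 - s) * (e s).re := by fun_prop
  refine ⟨_, hf, fun s hs => by simp [max_eq_left (sub_nonpos.2 hs)], ?_⟩
  rw [← ContinuousLinearMap.intervalIntegral_comp_comm _
    ((continuous_forcing_integrand A b hf).intervalIntegrable 0 1)]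
  have h1 : ∀ s : ℝ, w ((max 0 (1 - s) * (e s).re) • linearFlow A (-s) b) =
      ((max 0 (1 - s) * (e s).re : ℝ) * e s) * w b := by
    intro s
    rw [map_smul, linearFlow_left_eigenvector hw, Complex.real_smul, mul_assoc]
  simp only [h1, intervalIntegral.integral_mul_const]
  refine mul_ne_zero (fun h => ?_) hwb
  have hi : Continuous fun s : ℝ => ((max 0 (1 - s) * (e s).re : ℝ) : ℂ) * e s := by fun_prop
  have h2 := Complex.reCLM.intervalIntegral_comp_comm (hi.intervalIntegrable (μ := volume) 0 1)
  rw [h, map_zero] at h2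
  refine (integral_pos (f := fun s : ℝ => max 0 (1 - s) * (e s).re * (e s).re) one_pos ?_ ?_
    ⟨0, by simp, ?_⟩).ne' ?_
  · exact Continuous.continuousOn (by fun_prop)
  · intro s _
    rw [mul_assoc]
    exact mul_nonneg (le_max_left _ _) (mul_self_nonneg _)
  · simp [he]
  · refine Eq.trans ?_ h2
    refine integral_congr fun s _ => ?_
    simp only [Complex.reCLM_apply, Complex.re_ofReal_mul]

theorem exists_integral_forcedResponse_neg [FiniteDimensional ℝ E] {A : E →L[ℝ] E} {b : E}
    {l : E →L[ℝ] ℝ} (hobs : ∀ z, (∀ k : ℕ, l ((A ^ k) z) = 0) → z = 0)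
    {w : E →L[ℝ] ℂ} {μ : ℂ} (hw : ∀ x, w (A x) = μ * w x) (hwb : w b ≠ 0) (hμ : 0 < μ.re) :
    ∃ T : ℝ, 2 ≤ T ∧ ∃ f : ℝ → ℝ, Continuous f ∧
      ∫ t in (0 : ℝ)..T, l (forcedResponse A b f t) * f t < 0 := by
  obtain ⟨f, hf, hf1, hwc⟩ := exists_pulse hw hwb
  set v := ∫ s in (0 : ℝ)..1, f s • linearFlow A (-s) b
  obtain ⟨c, hc, hcb⟩ := exists_observability_bound A l hobs
  obtain ⟨m, hm⟩ := isCompact_Icc.exists_bound_of_continuousOn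
    (continuous_linearFlow A).continuousOn (s := Set.Icc (0 : ℝ) 1)
  have hm0 : 0 ≤ m := (norm_nonneg _).trans (hm 0 (by simp))
  -- C bounds the quadratic self-work of `g` relative to ‖z‖²; the 1 keeps it positive. The choice
  -- of ε gives ε² C = ε c / 2, half of the linear gain.
  set C := (‖l‖ * m) ^ 2 * (m * ‖b‖) * ‖l‖ + 1 with hC
  have hC0 : 0 < C := by positivity
  set ε := c / (2 * C) with hε
  have hε0 : 0 < ε := by positivity
  set K := ∫ t in (0 : ℝ)..1, l (forcedResponse A b f t) * f t with hK
  -- the free motion grows without bound, so at some time `θ` it outweighs the cost `K` of the pulse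
  obtain ⟨θ, hθ1, hθ⟩ : ∃ θ : ℝ, 1 ≤ θ ∧
      K < ε * (c / 2) * ‖linearFlow A θ v‖ ^ 2 := by
    have h1 : Tendsto (fun θ : ℝ => ‖w (linearFlow A θ v)‖) atTop atTop := by
      simp only [linearFlow_left_eigenvector hw, norm_mul, Complex.norm_exp]
      refine Tendsto.atTop_mul_const (norm_pos_iff.2 hwc) (Real.tendsto_exp_atTop.comp ?_)
      simpa using tendsto_id.const_mul_atTop hμ
    have h2 : Tendsto (fun θ : ℝ => ‖w‖ * ‖linearFlow A θ v‖) atTop atTop :=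
      tendsto_atTop_mono (fun θ => w.le_opNorm _) h1
    have hw0 : 0 < ‖w‖ := norm_pos_iff.2 fun h => hwb (by simp [h])
    have h3 : Tendsto (fun θ : ℝ => ‖linearFlow A θ v‖) atTop atTop :=
      (tendsto_const_mul_atTop_of_pos hw0).1 h2
    have h4 : Tendsto (fun θ : ℝ => ε * (c / 2) * ‖linearFlow A θ v‖ ^ 2) atTop atTop :=
      ((tendsto_pow_atTop two_ne_zero).comp h3).const_mul_atTop (by positivity)
    exact ((eventually_ge_atTop 1).and (h4.eventually_gt_atTop K)).exists
  set z := linearFlow A θ v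
  have hθ0 : 0 ≤ θ := by linarith
  -- The ramp makes the input continuous at θ and is the source of the weight s in the Gramian.
  set g : ℝ → ℝ := fun t => max 0 (t - θ) * l (linearFlow A (t - θ) z) with hg
  have hgc : Continuous g := by fun_prop
  have hg0 : ∀ t ≤ θ, g t = 0 := fun t ht => by simp [hg, max_eq_left (sub_nonpos.2 ht)]
  have hgb : ∀ r ∈ Set.Icc θ (θ + 1), |g r| ≤ ‖l‖ * m * ‖z‖ := by
    intro r hr
    have hr0 : r - θ ∈ Set.Icc (0 : ℝ) 1 := ⟨by linarith [hr.1], by linarith [hr.2]⟩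
    rw [hg, abs_mul, max_eq_right hr0.1, abs_of_nonneg hr0.1]
    refine (mul_le_of_le_one_left (abs_nonneg _) hr0.2).trans ?_
    rw [mul_assoc]
    refine (l.le_opNorm _).trans ?_
    gcongr
    refine (ContinuousLinearMap.le_opNorm _ _).trans ?_
    gcongr
    exact hm _ hr0
  have hfg : Continuous fun t => f t - ε * g t := by fun_prop
  refine ⟨θ + 1, by linarith, _, hfg, ?_⟩
  have hint : Continuous fun t =>
      l (forcedResponse A b (fun t => f t - ε * g t) t) * (f t - ε * g t) :=
    (l.continuous.comp (continuous_forcedResponse A b hfg)).mul hfg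
  have hxf := continuous_forcedResponse A b hf
  have hint1 : Continuous fun t => l (forcedResponse A b f t) * f t :=
    (l.continuous.comp hxf).mul hf
  rw [← integral_add_adjacent_intervals (hint.intervalIntegrable 0 θ)
    (hint.intervalIntegrable θ (θ + 1))]
  have e1 : ∫ t in (0 : ℝ)..θ,
      l (forcedResponse A b (fun t => f t - ε * g t) t) * (f t - ε * g t) = K := by
    have h1 : ∫ t in (1 : ℝ)..θ, l (forcedResponse A b f t) * f t = 0 := by
      refine integral_zero_ae (ae_of_all _ fun s hs => ?_)
      rw [Set.uIoc_of_le hθ1] at hs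
      simp [hf1 s hs.1.le]
    have h2 := integral_add_adjacent_intervals
      (hint1.intervalIntegrable (μ := volume) 0 1) (hint1.intervalIntegrable 1 θ)
    rw [h1, add_zero] at h2
    rw [hK, h2]
    refine integral_congr fun t ht => ?_
    rw [Set.uIcc_of_le hθ0] at ht
    simp only [forcedResponse_sub_const_mul A b hf hgc,
      forcedResponse_of_eq_zero_before A b hg0 ht.1 ht.2, hg0 t ht.2]
    simp
  have e2 : ∫ t in θ..(θ + 1),
      l (forcedResponse A b (fun t => f t - ε * g t) t) * (f t - ε * g t) ≤
      ε ^ 2 * (C * ‖z‖ ^ 2) - ε * ∫ s in (0 : ℝ)..1, s * l (linearFlow A s z) ^ 2 := by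
    have h1 : ∫ t in θ..(θ + 1),
        l (forcedResponse A b (fun t => f t - ε * g t) t) * (f t - ε * g t) =
        ∫ s in (0 : ℝ)..1, l (forcedResponse A b (fun t => f t - ε * g t) (s + θ)) *
          (f (s + θ) - ε * g (s + θ)) := by
      rw [intervalIntegral.integral_comp_add_right (fun t =>
        l (forcedResponse A b (fun t => f t - ε * g t) t) * (f t - ε * g t)), zero_add,
        add_comm]
    have h2 : ε ^ 2 * (C * ‖z‖ ^ 2) - ε * ∫ s in (0 : ℝ)..1, s * l (linearFlow A s z) ^ 2 =
        ∫ s in (0 : ℝ)..1, (ε ^ 2 * (C * ‖z‖ ^ 2) - ε * (s * l (linearFlow A s z) ^ 2)) := by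
      rw [intervalIntegral.integral_sub, intervalIntegral.integral_const_mul]
      · simp
      · simp
      · exact Continuous.intervalIntegrable (by fun_prop) _ _
    rw [h1, h2]
    refine integral_mono_on zero_le_one ?_ ?_ fun s hs => ?_
    · exact (hint.comp (continuous_add_const θ)).intervalIntegrable 0 1
    · exact Continuous.intervalIntegrable (by fun_prop) _ _
    · have hsθ : s + θ ∈ Set.Icc θ (θ + 1) := ⟨by linarith [hs.1], by linarith [hs.2]⟩
      have hx1 : forcedResponse A b f (s + θ) = linearFlow A s z := by
        rw [forcedResponse_of_eq_zero_after A b hf hf1 (hθ1.trans hsθ.1), linearFlow_add_apply]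
      have hgs : g (s + θ) = s * l (linearFlow A s z) := by
        simp [hg, max_eq_right hs.1]
      have hB : l (forcedResponse A b g (s + θ)) * g (s + θ) ≤ C * ‖z‖ ^ 2 := by
        refine (le_abs_self _).trans ?_
        rw [abs_mul]
        calc |l (forcedResponse A b g (s + θ))| * |g (s + θ)|
            ≤ (‖l‖ * (‖l‖ * m * ‖z‖ * (m * ‖b‖))) * (‖l‖ * m * ‖z‖) := by
              gcongr
              · refine (l.le_opNorm _).trans ?_
                gcongr
                rw [add_comm]
                exact norm_forcedResponse_le A b hgc hm hθ0 hs hg0 hgb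
              · exact hgb _ hsθ
          _ = (C - 1) * ‖z‖ ^ 2 := by rw [hC]; ring
          _ ≤ C * ‖z‖ ^ 2 := by gcongr; linarith
      rw [forcedResponse_sub_const_mul A b hf hgc, hx1, hf1 _ (hθ1.trans hsθ.1), map_sub,
        map_smul, smul_eq_mul]
      have h3 := mul_le_mul_of_nonneg_left hB (sq_nonneg ε)
      rw [hgs] at h3 ⊢
      nlinarith [h3]
  have h5 : ε ^ 2 * (C * ‖z‖ ^ 2) = ε * (c / 2) * ‖z‖ ^ 2 := by
    rw [hε]; field_simp
  have h6 := mul_le_mul_of_nonneg_left (hcb z) hε0.le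
  rw [e1]
  nlinarith

end Work

/-! ### Krylov matrices and genericity -/

section Krylov

open Matrix

variable {n : ℕ}

/-- The matrix with rows `b, A b, …, A ^ (n - 1) b`. -/
def krylovMatrix {R : Type*} [CommRing R] (A : Matrix (Fin n) (Fin n) R) (b : Fin n → R) :
    Matrix (Fin n) (Fin n) R :=
  Matrix.of fun i : Fin n => (A ^ (i : ℕ)) *ᵥ b

theorem continuous_det_krylovMatrix (b : Fin n → ℝ) :
    Continuous fun A : Matrix (Fin n) (Fin n) ℝ => (krylovMatrix A b).det := by
  refine Continuous.matrix_det (continuous_matrix fun i j => ?_)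
  have : Continuous fun A : Matrix (Fin n) (Fin n) ℝ => (A ^ (i : ℕ)) *ᵥ b := by fun_prop
  exact (continuous_apply j).comp this

theorem exists_det_krylovMatrix_ne_zero {b : Fin n → ℝ} (hb : b ≠ 0) :
    ∃ A : Matrix (Fin n) (Fin n) ℝ, (krylovMatrix A b).det ≠ 0 := by
  obtain ⟨j, hj⟩ := Function.ne_iff.1 hb
  obtain ⟨m, rfl⟩ : ∃ m, n = m + 1 := ⟨n - 1, by have := j.pos; omega⟩
  obtain ⟨B, hB⟩ : ∃ B : Module.Basis (Fin (m + 1)) ℝ (Fin (m + 1) → ℝ), B 0 = b := by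
    obtain ⟨L, hL⟩ := SeparatingDual.exists_continuousLinearEquiv_apply_eq (R := ℝ)
      (x := (Pi.single 0 1 : Fin (m + 1) → ℝ)) (y := b) (by simp) hb
    exact ⟨(Pi.basisFun ℝ _).map L.toLinearEquiv, by simpa using hL⟩
  -- The cyclic shift of a basis that starts with b: its Krylov vectors are the basis itself.
  let F : (Fin (m + 1) → ℝ) →ₗ[ℝ] (Fin (m + 1) → ℝ) := B.constr ℝ fun i => B (i + 1)
  have hF : ∀ k : ℕ, (F ^ k) b = B (Fin.ofNat (m + 1) k) := by
    intro k
    induction k with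
    | zero => exact hB.symm
    | succ k ih =>
      rw [pow_succ', Module.End.mul_apply, ih, Module.Basis.constr_basis]
      congr 1
      exact Fin.ext (by simp [Fin.val_add])
  refine ⟨LinearMap.toMatrix' F, ?_⟩
  have h : krylovMatrix (LinearMap.toMatrix' F) b = Matrix.of B := by
    ext i j
    have : LinearMap.toMatrix' F ^ (i : ℕ) = LinearMap.toMatrix' (F ^ (i : ℕ)) :=
      (map_pow LinearMap.toMatrixAlgEquiv' F i).symm
    rw [krylovMatrix, of_apply, of_apply, this, LinearMap.toMatrix'_mulVec, hF, Fin.ofNat_val_eq_self]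
  rw [h, ← isUnit_iff_ne_zero, ← Matrix.isUnit_iff_isUnit_det,
    ← Matrix.linearIndependent_rows_iff_isUnit]
  exact B.linearIndependent

/-- On the line from A to a good matrix A₀ the determinant is a polynomial in t, nonzero at t = 1.
It has finitely many roots, so good matrices accumulate at t = 0. -/
theorem dense_det_krylovMatrix_ne_zero {b : Fin n → ℝ} (hb : b ≠ 0) :
    Dense {A : Matrix (Fin n) (Fin n) ℝ | (krylovMatrix A b).det ≠ 0} := by
  intro A
  obtain ⟨A₀, hA₀⟩ := exists_det_krylovMatrix_ne_zero hb
  let Q : Matrix (Fin n) (Fin n) (Polynomial ℝ) :=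
    A.map Polynomial.C + (Polynomial.X : Polynomial ℝ) • (A₀ - A).map Polynomial.C
  let p : Polynomial ℝ := (krylovMatrix Q fun i => Polynomial.C (b i)).det
  have hp : ∀ t : ℝ, p.eval t = (krylovMatrix (A + t • (A₀ - A)) b).det := by
    intro t
    rw [← Polynomial.coe_evalRingHom, RingHom.map_det]
    congr 1
    have hQ : (Polynomial.evalRingHom t).mapMatrix Q = A + t • (A₀ - A) := by
      ext i j; simp [Q]
    ext i j
    have h1 : (Polynomial.evalRingHom t).mapMatrix (Q ^ (i : ℕ)) = (A + t • (A₀ - A)) ^ (i : ℕ) := by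
      rw [map_pow, hQ]
    rw [krylovMatrix, krylovMatrix, of_apply, ← h1]
    simp [Matrix.mulVec, dotProduct, Polynomial.eval_finsetSum]
  have hp0 : p ≠ 0 := by
    intro h
    have := hp 1
    simp [h] at this
    exact hA₀ this.symm
  have hd : Dense {t : ℝ | p.IsRoot t}ᶜ :=
    (Polynomial.finite_setOfPred_isRoot hp0).countable.dense_compl ℝ
  have hc : Continuous fun t : ℝ => A + t • (A₀ - A) := by fun_prop
  have := map_mem_closure (s := {t : ℝ | p.IsRoot t}ᶜ)
    (t := {A : Matrix (Fin n) (Fin n) ℝ | (krylovMatrix A b).det ≠ 0}) hc (hd 0)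
    (fun t ht => by
      rw [Set.mem_ofPred_eq, ← hp]; exact ht)
  simpa using this

theorem eq_zero_of_dotProduct_pow_mulVec {K : Type*} [Field K] {A : Matrix (Fin n) (Fin n) K}
    {b : Fin n → K} (h : (krylovMatrix A b).det ≠ 0) {z : Fin n → K}
    (hz : ∀ k : ℕ, z ⬝ᵥ ((A ^ k) *ᵥ b) = 0) : z = 0 := by
  by_contra hne
  refine h (Matrix.exists_mulVec_eq_zero_iff.1 ⟨z, hne, ?_⟩)
  ext i
  exact (dotProduct_comm _ _).trans (hz i)

theorem exists_left_eigenvector {A : Matrix (Fin n) (Fin n) ℂ} {μ : ℂ}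
    (h : Module.End.HasEigenvalue (Matrix.toLin' A) μ) : ∃ v ≠ 0, v ᵥ* A = μ • v := by
  obtain ⟨x, hx⟩ := h.exists_hasEigenvector
  have hdet : (A - μ • (1 : Matrix (Fin n) (Fin n) ℂ)).det = 0 :=
    Matrix.exists_mulVec_eq_zero_iff.1 ⟨x, hx.2, by
      have := hx.apply_eq_smul
      rw [Matrix.toLin'_apply] at this
      rw [sub_mulVec, this, smul_mulVec, one_mulVec, sub_self]⟩
  obtain ⟨v, hv, hvA⟩ := Matrix.exists_vecMul_eq_zero_iff.2 hdet
  refine ⟨v, hv, ?_⟩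
  rwa [vecMul_sub, vecMul_smul, vecMul_one, sub_eq_zero] at hvA

theorem hasNegativeWork_of_det_krylovMatrix_ne_zero {A P : Matrix (Fin n) (Fin n) ℝ}
    {b : Fin n → ℝ} (hPb : P *ᵥ b = b) (hA : (krylovMatrix A b).det ≠ 0)
    (hAt : (krylovMatrix Aᵀ b).det ≠ 0) (hu : HasUnstableEigenvalue A) :
    ∃ T : ℝ, 2 ≤ T ∧ HasNegativeWork A P T := by
  obtain ⟨μ, hμ, hre⟩ := hu
  obtain ⟨v, hv, hvA⟩ := exists_left_eigenvector hμ
  let F : (Fin n → ℝ) →L[ℝ] (Fin n → ℝ) := (Matrix.toLin' A).toContinuousLinearMap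
  have hFp : ∀ (k : ℕ) z, (F ^ k) z = (A ^ k) *ᵥ z := by
    intro k
    induction k with
    | zero => simp
    | succ k ih =>
      intro z
      rw [pow_succ, pow_succ, ← mulVec_mulVec, ← ih]
      rfl
  let l : (Fin n → ℝ) →L[ℝ] ℝ := LinearMap.toContinuousLinearMap (dotProductBilin ℝ ℝ b)
  have hl : ∀ z, l z = b ⬝ᵥ z := fun z => rfl
  let w : (Fin n → ℝ) →L[ℝ] ℂ := LinearMap.toContinuousLinearMap
    (((dotProductBilin ℂ ℂ v).restrictScalars ℝ).comp
      (Complex.ofRealCLM.toLinearMap.compLeft (Fin n)))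
  have hw : ∀ z : Fin n → ℝ, w z = v ⬝ᵥ (Complex.ofReal ∘ z) := fun z => rfl
  have hmap : ∀ z : Fin n → ℝ, Complex.ofReal ∘ (A *ᵥ z) =
      (A.map Complex.ofReal) *ᵥ (Complex.ofReal ∘ z) := fun z =>
    funext fun i => RingHom.map_mulVec Complex.ofRealHom A z i
  have hwF : ∀ z, w (F z) = μ * w z := by
    intro z
    have : F z = A *ᵥ z := rfl
    rw [hw, hw, this, hmap, dotProduct_mulVec, hvA, smul_dotProduct, smul_eq_mul]
  -- Otherwise v annihilates all `A ^ k` b; these are real, so Re v and Im v both vanish.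
  have hwb : w b ≠ 0 := by
    intro h0
    have hk : ∀ k : ℕ, w ((A ^ k) *ᵥ b) = 0 := by
      intro k
      induction k with
      | zero => simpa using h0
      | succ k ih =>
        rw [pow_succ', ← mulVec_mulVec]
        exact (hwF _).trans (by rw [ih, mul_zero])
    refine hv (funext fun i => Complex.ext ?_ ?_)
    · refine congrFun (eq_zero_of_dotProduct_pow_mulVec hA (z := fun i => (v i).re) fun k => ?_) i
      have := congrArg Complex.re (hk k)
      rw [hw] at this
      simpa [dotProduct] using this
    · refine congrFun (eq_zero_of_dotProduct_pow_mulVec hA (z := fun i => (v i).im) fun k => ?_) i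
      have := congrArg Complex.im (hk k)
      rw [hw] at this
      simpa [dotProduct] using this
  have hobs : ∀ z, (∀ k : ℕ, l ((F ^ k) z) = 0) → z = 0 := by
    intro z hz
    refine eq_zero_of_dotProduct_pow_mulVec hAt fun k => ?_
    rw [← hz k, hl, hFp, ← transpose_pow, mulVec_transpose, dotProduct_comm, dotProduct_mulVec]
  obtain ⟨T, hT, f, hf, hneg⟩ := exists_integral_forcedResponse_neg hobs hwF hwb hre
  refine ⟨T, hT, fun t => f t • b, Continuous.continuousOn (by fun_prop),
    forcedResponse F b f, ⟨forcedResponse_zero F b f, fun t _ => ?_⟩, ?_⟩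
  · simp only [mulVec_smul, hPb]
    exact (hasDerivAt_forcedResponse F b hf t).hasDerivWithinAt
  · refine lt_of_eq_of_lt ?_ hneg
    simp only [portWork, mulVec_smul, hPb, dotProduct_smul, smul_eq_mul, hl]
    congr 1; ext t
    rw [dotProduct_comm, mul_comm]

end Krylov

theorem theorem7 (n : ℕ) (P : Matrix (Fin n) (Fin n) ℝ) (hP : IsIdempotentElem P) (hP0 : P ≠ 0) :
    ∃ M : Set (Matrix (Fin n) (Fin n) ℝ), IsOpen M ∧ Dense M ∧
      ∀ A ∈ M, HasUnstableEigenvalue A →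
        IsLocallyActive A P ∧ ∃ T : ℝ, 2 ≤ T ∧ HasNegativeWork A P T := by
  obtain ⟨b, hPb, hb⟩ : ∃ b, P.mulVec b = b ∧ b ≠ 0 := by
    obtain ⟨e, he⟩ : ∃ e, P.mulVec e ≠ 0 := by
      by_contra! h
      exact hP0 (Matrix.toLin'.injective (LinearMap.ext fun e => by simp [h e]))
    exact ⟨P.mulVec e, by rw [Matrix.mulVec_mulVec, hP.eq], he⟩
  set U := {A : Matrix (Fin n) (Fin n) ℝ | (krylovMatrix A b).det ≠ 0}
  have hUo : IsOpen U := (continuous_det_krylovMatrix b).isOpen_preimage _ isOpen_ne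
  have hUd : Dense U := dense_det_krylovMatrix_ne_zero hb
  let τ : Matrix (Fin n) (Fin n) ℝ ≃ₜ Matrix (Fin n) (Fin n) ℝ :=
    ⟨⟨Matrix.transpose, Matrix.transpose, Matrix.transpose_transpose, Matrix.transpose_transpose⟩,
      continuous_id.matrix_transpose, continuous_id.matrix_transpose⟩
  -- The first set gives excitability from b, its transpose gives observability through b.
  refine ⟨U ∩ τ ⁻¹' U, hUo.inter (hUo.preimage τ.continuous),
    hUd.inter_of_isOpen_left (hUd.preimage τ.isOpenMap) hUo, fun A hA hu => ?_⟩
  obtain ⟨T, hT, hW⟩ := hasNegativeWork_of_det_krylovMatrix_ne_zero hPb hA.1 hA.2 hu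
  exact ⟨⟨T, by linarith, hW⟩, T, hT, hW⟩
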